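/- **Model.** There are $N$ rider types and time is discrete. In each period at most one rider arrives, of type $i$ with probability $\Lambda_i\ge 0$, $\sum_i\Lambda_i\le 1$, independently over periods. The platform fixes conversion probabilities $\boldsymbol\lambda\in[0,1]^N$ by posting prices $p_i(\lambda_i)$, so that a type-$i$ rider makes a request in a period with probability $\Lambda_i\lambda_i$. A solo trip of type $i$ takes $\ell_i\ge 1$ periods (an integer), travel costs $c$ per period, and an unmatched new rider waits up to $T\ge 0$ periods at the origin before departing; $T=0$ is the pure on-trip model and $T>0$ the combined pre-trip/on-trip model. The states of an existing solo rider are $\mathcal C=\{(i,u): i\in[N],\ -T+1\le u\le \ell_i-1\}$, where $u\le 0$ means waiting at the origin and $u\ge1$ is the number of periods since departure. For $(j,u)\in\mathcal C$, $\mathcal N^+_{j,u}\subseteq[N]$ is the set of types compatible with $(j,u)$, and $\ell_{i,j}^u$ is the length of the shared trip when a new type-$i$ rider is matched with $(j,u)$. The results hold for arbitrary price functions $p_i:[0,1]\to\mathbb R$, arbitrary compatibility sets $\mathcal N^+_{j,u}$, and arbitrary real $c$ and $\ell_{i,j}^u$. The state of the system is the set $\mathbf s\subseteq\mathcal C$ of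 occupied solo states. A stationary matching policy $\boldsymbol\phi$ decides, when a type-$i$ rider requests in state $\mathbf s$, either to match that rider with some $(j,u)\in\mathbf s$ such that $i\in\mathcal N^+_{j,u}$ (the rider $(j,u)$ then leaves the set of solo riders), or not to match (the new rider then has position $(i,-T)$). At the end of the period every remaining solo rider moves from $(i,u)$ to $(i,u+1)$; riders at $u=\ell_i-1$ reach their destination and leave. Each type-$i$ rider who reaches the destination unmatched yields the profit $p_i(\lambda_i)-c\ell_i$, and each match of a new type-$i$ rider with $(j,u)$ yields $p_i(\lambda_i)+p_j(\lambda_j)-c\max\{u,0\}-c\ell_{i,j}^u$. With $\Pi_t^{\boldsymbol\lambda,\boldsymbol\phi}$ the total profit of the first $t$ periods, let $$\Pi=\sup_{\boldsymbol\lambda,\boldsymbol\phi}\ \lim_{t\to\infty}\tfrac1t\,\mathbb E\big[\Pi_t^{\boldsymbol\lambda,\boldsymbol\phi}\big].$$ **Fluid relaxation.** Let $$g=\sup_{\boldsymbol\lambda\in[0,1]^N}\Big(\sum_i\Lambda_i\lambda_i p_i(\lambda_i)-C(\boldsymbol\lambda)\Big),$$ where $C(\boldsymbol\lambda)$ is the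 minimum of $$\sum_{i}\sum_{u=0}^{\ell_i-1}c\,y_i^u+\sum_i\sum_{(j,u)\in\mathcal C:\,i\in\mathcal N^+_{j,u}}c\,\ell_{i,j}^u\,x_{i,j}^u$$ over all $x_{i,j}^u\ge0$ ($(j,u)\in\mathcal C$, $i\in\mathcal N^+_{j,u}$) and $y_i^u\ge0$ ($i\in[N]$, $-T\le u\le\ell_i-1$) such that $$\sum_{(j,u)\in\mathcal C:\,i\in\mathcal N^+_{j,u}}x_{i,j}^u+y_i^{-T}=\Lambda_i\lambda_i\quad(i\in[N]),$$ $$\sum_{i\in\mathcal N^+_{j,u}}x_{i,j}^u+y_j^u=y_j^{u-1}\quad((j,u)\in\mathcal C),$$ $$\Lambda_i\lambda_i\,y_j^u\ \ge\ \Big(1-\sum_{k\in\mathcal N^+_{j,u}}\Lambda_k\lambda_k\Big)x_{i,j}^u\quad((j,u)\in\mathcal C,\ i\in\mathcal N^+_{j,u}).$$ **Proposition.** For every initial state $\mathbf s_0\subseteq\mathcal C$, the limit defining the long-run average profit exists for all $\boldsymbol\lambda$ and $\boldsymbol\phi$, the minimum defining $C(\boldsymbol\lambda)$ is attained for every $\boldsymbol\lambda\in[0,1]^N$,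 and $g\ge\Pi$ (both suprema taken in the extended reals). -/

import Mathlib

open MeasureTheory Filter Topology

/-- Data of the shared-ride pricing and matching model with `N` rider types.

Positions of riders are integers `u`. A rider of type `i` who has just converted has position `-T`;
`-T < u ≤ 0` means that the rider still waits at the origin with `|u|` waiting periods left, and
`1 ≤ u ≤ ℓ i - 1` means that the rider left the origin `u` periods ago and travels alone.
The pure on-trip model is the case `T = 0`. -/
structure RideModel (N : ℕ) where
  /-- probability that a rider of type `i` arrives in a given period -/
  Λ : Fin N → ℝ
  Λ_nonneg : ∀ i, 0 ≤ Λ i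
  Λ_sum_le_one : ∑ i, Λ i ≤ 1
  /-- the price `p_i(z)` which induces the conversion probability `z` -/
  price : Fin N → unitInterval → ℝ
  /-- operational cost per unit of distance -/
  c : ℝ
  /-- solo trip length `ℓ_i` -/
  ℓ : Fin N → ℕ
  ℓ_pos : ∀ i, 1 ≤ ℓ i
  /-- maximal number of waiting periods before departure -/
  T : ℕ
  /-- `sharedLen i (j, u)` is the length `ℓ_{i,j}^u` of the shared trip, from the time of the match,
  when a new rider of type `i` is matched with a solo rider in state `(j, u)` -/
  sharedLen : Fin N → Fin N × ℤ → ℝ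
  /-- `compat (j, u)` is the set `𝒩⁺_{j,u}` of the types which are compatible with a solo rider
  in state `(j, u)` -/
  compat : Fin N × ℤ → Finset (Fin N)

/-- What is observed in one period: no request (`none`), or a request by one rider of type `i`
(`some i`). -/
abbrev Request (N : ℕ) : Type := Option (Fin N)

instance instMeasurableSpaceRequest (N : ℕ) : MeasurableSpace (Request N) := ⊤

/-- A system state: the set of all `(i, u)` with a solo rider present in that state. -/
abbrev SystemState (N : ℕ) : Type := Finset (Fin N × ℤ)

namespace RideModel

variable {N : ℕ} (M : RideModel N)

/-- The set `𝒞` of the states `(i, u)`, `-T + 1 ≤ u ≤ ℓ_i - 1`, of a solo rider. -/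
noncomputable def soloStates : Finset (Fin N × ℤ) :=
  Finset.univ.biUnion fun i : Fin N =>
    (Finset.Icc (-(M.T : ℤ) + 1) ((M.ℓ i : ℤ) - 1)).image fun u => (i, u)

theorem mem_soloStates (i : Fin N) (u : ℤ) :
    (i, u) ∈ M.soloStates ↔ -(M.T : ℤ) + 1 ≤ u ∧ u ≤ (M.ℓ i : ℤ) - 1 := by
  simp [soloStates]

/-- A static pricing policy, given by the conversion probabilities `lam i ∈ [0, 1]`. -/
abbrev PricingPolicy (_ : RideModel N) : Type := Fin N → unitInterval

/-- A stationary matching policy. When a rider of type `i` converts while the system is in state `s`,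
`act i s = some (j, u)` matches the new rider with the solo rider in state `(j, u)`, which must be
present and compatible; `act i s = none` means that the new rider is not matched. -/
structure MatchingPolicy where
  act : Fin N → SystemState N → Option (Fin N × ℤ)
  admissible : ∀ i s q, act i s = some q → q ∈ s ∧ i ∈ M.compat q

/-- Rate `Λ_i λ_i` of requests of type `i`. -/
def rate (lam : M.PricingPolicy) (i : Fin N) : ℝ := M.Λ i * (lam i : ℝ)

theorem rate_nonneg (lam : M.PricingPolicy) (i : Fin N) : 0 ≤ M.rate lam i :=
  mul_nonneg (M.Λ_nonneg i) (lam i).2.1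

theorem sum_rate_le_one (lam : M.PricingPolicy) : ∑ i, M.rate lam i ≤ 1 :=
  (Finset.sum_le_sum fun i _ =>
    mul_le_of_le_one_right (M.Λ_nonneg i) (lam i).2.2).trans M.Λ_sum_le_one

/-! ### The Markov decision process -/

/-- Law of the request of one period: type `i` with probability `Λ_i λ_i`, no request otherwise. -/
noncomputable def requestLaw (lam : M.PricingPolicy) : Measure (Request N) :=
  ENNReal.ofReal (1 - ∑ i, M.rate lam i) • Measure.dirac none +
    ∑ i, ENNReal.ofReal (M.rate lam i) • Measure.dirac (some i)

instance instIsProbabilityMeasureRequestLaw (lam : M.PricingPolicy) :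
    IsProbabilityMeasure (M.requestLaw lam) := by
  constructor
  have h0 : ∀ i ∈ Finset.univ, 0 ≤ M.rate lam i := fun i _ => M.rate_nonneg lam i
  have h1 : 0 ≤ 1 - ∑ i, M.rate lam i := sub_nonneg.2 (M.sum_rate_le_one lam)
  simp only [requestLaw, Measure.add_apply, Measure.smul_apply, Measure.finsetSum_apply,
    measure_univ, smul_eq_mul, mul_one]
  rw [← ENNReal.ofReal_sum_of_nonneg h0, ← ENNReal.ofReal_add h1 (Finset.sum_nonneg h0)]
  simp

/-- Law of the sequence of requests in the periods `0, 1, 2, …`: independent, identically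
distributed. -/
noncomputable def processLaw (lam : M.PricingPolicy) : Measure (ℕ → Request N) :=
  Measure.infinitePi fun _ : ℕ => M.requestLaw lam

variable {M}

/-- The riders who continue alone after the decision of a period which starts in state `s` with
request `a`; a new rider of type `i` who is not matched appears as `(i, -T)`. -/
def remaining (φ : M.MatchingPolicy) (s : SystemState N) (a : Request N) : SystemState N :=
  match a with
  | none => s
  | some i =>
    match φ.act i s with
    | none => insert (i, -(M.T : ℤ)) s
    | some q => s.erase q

/-- The next state: all remaining riders move forward by one, and those who reach their destination
leave the system. -/
noncomputable def step (φ : M.MatchingPolicy) (s : SystemState N) (a : Request N) : SystemState N :=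
  ((remaining φ s a).image fun q => (q.1, q.2 + 1)).filter fun q => q ∈ M.soloStates

/-- State at time `t` when the system starts in `s₀` and the requests are `ω`. -/
noncomputable def stateAt (φ : M.MatchingPolicy) (s₀ : SystemState N) (ω : ℕ → Request N) : ℕ → SystemState N
  | 0 => s₀
  | t + 1 => step φ (stateAt φ s₀ ω t) (ω t)

/-- Number of riders of type `i` who, in the first `t` periods, complete their trip without having
been matched. -/
noncomputable def soloCount (φ : M.MatchingPolicy) (s₀ : SystemState N) (ω : ℕ → Request N) (t : ℕ)
    (i : Fin N) : ℕ :=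
  ((Finset.range t).filter fun τ =>
    (i, (M.ℓ i : ℤ) - 1) ∈ remaining φ (stateAt φ s₀ ω τ) (ω τ)).card

/-- Number of matches, in the first `t` periods, between a new rider of type `i` and a solo rider in
state `q = (j, u)`. -/
noncomputable def matchCount (φ : M.MatchingPolicy) (s₀ : SystemState N) (ω : ℕ → Request N) (t : ℕ)
    (i : Fin N) (q : Fin N × ℤ) : ℕ :=
  ((Finset.range t).filter fun τ =>
    ω τ = some i ∧ φ.act i (stateAt φ s₀ ω τ) = some q).card

/-- Total profit in the first `t` periods: `p_i - c ℓ_i` for each rider who ends up solo, and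
`p_i + p_j - c max(u, 0) - c ℓ_{i,j}^u` for each match of a new rider of type `i` with a solo rider
in state `(j, u)`; the latter has travelled the distance `max(u, 0)` before. -/
noncomputable def totalProfit (lam : M.PricingPolicy) (φ : M.MatchingPolicy) (s₀ : SystemState N)
    (t : ℕ) (ω : ℕ → Request N) : ℝ :=
  ∑ i, (soloCount φ s₀ ω t i : ℝ) * (M.price i (lam i) - M.c * M.ℓ i) +
    ∑ i, ∑ q ∈ M.soloStates, (matchCount φ s₀ ω t i q : ℝ) *
      (M.price i (lam i) + M.price q.1 (lam q.1)
        - M.c * ((max q.2 0 : ℤ) : ℝ) - M.c * M.sharedLen i q)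

/-- Expected profit per period over the first `t` periods. -/
noncomputable def averageProfit (lam : M.PricingPolicy) (φ : M.MatchingPolicy)
    (s₀ : SystemState N) (t : ℕ) : ℝ :=
  (1 / (t : ℝ)) * ∫ ω, totalProfit lam φ s₀ t ω ∂(M.processLaw lam)

/-- Long-run average profit of a pair of stationary policies. -/
noncomputable def longRunProfit (lam : M.PricingPolicy) (φ : M.MatchingPolicy)
    (s₀ : SystemState N) : ℝ :=
  limUnder atTop (averageProfit lam φ s₀)

variable (M)

/-- The optimal long-run average profit over all static pricing policies and all stationary matching
policies. It is an extended real number, as the prices need not be bounded. -/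
noncomputable def optimalProfit (s₀ : SystemState N) : EReal :=
  ⨆ (lam : M.PricingPolicy) (φ : M.MatchingPolicy), ((longRunProfit lam φ s₀ : ℝ) : EReal)

/-! ### The fluid relaxation -/

/-- Feasible flows of the inner linear program: `x i (j, u)` stands for `x_{i,j}^u` and `y i u` for
`y_i^u`. Values of `x` and `y` outside the index sets of the program play no role. -/
structure IsFluidFeasible (lam : M.PricingPolicy) (x : Fin N → Fin N × ℤ → ℝ)
    (y : Fin N → ℤ → ℝ) : Prop where
  demand : ∀ i, ∑ q ∈ M.soloStates with i ∈ M.compat q, x i q + y i (-(M.T : ℤ)) = M.rate lam i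
  balance : ∀ j u, (j, u) ∈ M.soloStates →
    ∑ i ∈ M.compat (j, u), x i (j, u) + y j u = y j (u - 1)
  ratio : ∀ j u, (j, u) ∈ M.soloStates → ∀ i ∈ M.compat (j, u),
    (1 - ∑ k ∈ M.compat (j, u), M.rate lam k) * x i (j, u) ≤ M.rate lam i * y j u
  x_nonneg : ∀ j u, (j, u) ∈ M.soloStates → ∀ i ∈ M.compat (j, u), 0 ≤ x i (j, u)
  y_nonneg : ∀ i u, -(M.T : ℤ) ≤ u → u ≤ (M.ℓ i : ℤ) - 1 → 0 ≤ y i u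

/-- Objective of the inner linear program. -/
noncomputable def flowCost (x : Fin N → Fin N × ℤ → ℝ) (y : Fin N → ℤ → ℝ) : ℝ :=
  ∑ i, ∑ u ∈ Finset.Icc (0 : ℤ) ((M.ℓ i : ℤ) - 1), M.c * y i u +
    ∑ i, ∑ q ∈ M.soloStates with i ∈ M.compat q, M.c * M.sharedLen i q * x i q

/-- The objective values of the feasible flows of the inner linear program. -/
def feasibleCosts (lam : M.PricingPolicy) : Set ℝ :=
  {v | ∃ x y, M.IsFluidFeasible lam x y ∧ M.flowCost x y = v}

/-- Optimal value `C(λ)` of the inner linear program. -/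
noncomputable def fluidCost (lam : M.PricingPolicy) : ℝ := sInf (M.feasibleCosts lam)

/-- Optimal value `g` of the fluid relaxation. -/
noncomputable def fluidValue : EReal :=
  ⨆ lam : M.PricingPolicy,
    ((∑ i, M.rate lam i * M.price i (lam i) - M.fluidCost lam : ℝ) : EReal)

end RideModel

/-!
The states of the system form a finite Markov chain. Its transition operator is a contraction of the
functions of the state in the sup norm, so by the mean ergodic theorem the time averages converge,
and their limits are integrals against a stationary distribution `π`. Under `π` the frequencies of
the matches and of the positions of the solo riders are a feasible flow of the inner linear program.
For the ratio constraint: when the policy would match type `i` with the rider in state `(j, u)`, the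
match occurs with probability `Λ_i λ_i`, while that rider stays alone with probability at least
`1 - ∑ Λ_k λ_k`, the sum being over the compatible types `k`.

Profits are collected at the matches and at the ends of the solo trips. Summation by parts along the
positions of each type turns them into the fluid objective, so the long-run profit is at most the
fluid value. The minimum of the linear program is attained by compactness, once the coordinates
outside its index sets are set to zero.
-/

section MeanErgodic

variable {𝕜 E : Type*} [RCLike 𝕜] [NormedAddCommGroup E] [NormedSpace 𝕜 E]

theorem disjoint_eqLocus_range_sub_one {f : E →ₗ[𝕜] E} (hf : LipschitzWith 1 f) :
    Disjoint (LinearMap.eqLocus f 1) (LinearMap.range (f - 1)) := by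
  rw [Submodule.disjoint_def]
  rintro _ hfix ⟨z, rfl⟩
  have hfixed : Function.IsFixedPt f ((f - 1) z) := hfix
  have hbounded : Bornology.IsBounded (Set.range fun n => id (f^[n] z)) :=
    isBounded_iff_forall_norm_le.2 ⟨‖z‖, Set.forall_mem_range.2 fun n => by
      simpa [iterate_map_zero (f : E →+ E) n] using (hf.iterate n).dist_le_mul z 0⟩
  have hsub : ∀ n, birkhoffAverage 𝕜 f id n ((f - 1) z) =
      birkhoffAverage 𝕜 f id n (f z) - birkhoffAverage 𝕜 f id n z := fun n => by
    simp [birkhoffAverage, birkhoffSum, Finset.sum_sub_distrib, smul_sub]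
  refine tendsto_nhds_unique (hfixed.tendsto_birkhoffAverage 𝕜 id) ?_
  simpa only [hsub] using tendsto_birkhoffAverage_apply_sub_birkhoffAverage 𝕜 hbounded

theorem isCompl_eqLocus_range_sub_one [FiniteDimensional 𝕜 E] {f : E →ₗ[𝕜] E}
    (hf : LipschitzWith 1 f) :
    IsCompl (LinearMap.eqLocus f 1) (LinearMap.range (f - 1)) := by
  refine (Submodule.isCompl_iff_disjoint _ _ ?_).2 (disjoint_eqLocus_range_sub_one hf)
  rw [LinearMap.eqLocus_eq_ker_sub, add_comm, LinearMap.finrank_range_add_finrank_ker]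

theorem exists_tendsto_birkhoffAverage [FiniteDimensional 𝕜 E] {f : E →ₗ[𝕜] E}
    (hf : LipschitzWith 1 f) :
    ∃ P : E →ₗ[𝕜] E, (∀ x, Tendsto (birkhoffAverage 𝕜 f id · x) atTop (𝓝 (P x))) ∧
      ∀ x, P (f x) = P x := by
  have hcompl := isCompl_eqLocus_range_sub_one hf
  let p := Submodule.projectionOnto _ _ hcompl
  have hp : ∀ y, p y = 0 ↔ y ∈ LinearMap.range (f - 1) := fun _ =>
    Submodule.projectionOnto_apply_eq_zero_iff hcompl
  refine ⟨(LinearMap.eqLocus f 1).subtype ∘ₗ p, fun x => ?_, fun x => ?_⟩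
  · exact LinearMap.tendsto_birkhoffAverage_of_ker_subset_closure f hf
      (LinearMap.toContinuousLinearMap p) (Submodule.projectionOnto_apply_left hcompl)
      (fun y hy => subset_closure ((hp y).1 hy)) x
  · have hpx : p (f x - x) = 0 := (hp _).2 ⟨x, by simp⟩
    rw [map_sub, sub_eq_zero] at hpx
    simp only [LinearMap.comp_apply, hpx]

end MeanErgodic

theorem exists_mem_stdSimplex_forall_eq_dotProduct {S : Type*} [Fintype S]
    {L : (S → ℝ) →ₗ[ℝ] ℝ} (hL : ∀ f, 0 ≤ f → 0 ≤ L f) (hone : L 1 = 1) :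
    ∃ π ∈ stdSimplex ℝ S, ∀ f, L f = π ⬝ᵥ f := by
  classical
  let π : S → ℝ := fun s => L fun r => if s = r then 1 else 0
  have hπ : ∀ f, L f = π ⬝ᵥ f := fun f => by
    rw [L.pi_apply_eq_sum_univ, dotProduct_comm]
    rfl
  refine ⟨π, ⟨fun s => hL _ fun r => ?_, ?_⟩, hπ⟩
  · dsimp only
    split_ifs <;> norm_num
  · rw [← dotProduct_one, ← hπ, hone]

section InfinitePi

variable {ι : Type*} {X : ι → Type*} [∀ i, MeasurableSpace (X i)]

theorem indepFun_restrict_eval_infinitePi (P : ∀ i, Measure (X i)) [∀ i, IsProbabilityMeasure (P i)]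
    {s : Finset ι} {i : ι} (hi : i ∉ s) :
    ProbabilityTheory.IndepFun s.restrict (Function.eval i) (Measure.infinitePi P) := by
  have hindep := (ProbabilityTheory.iIndepFun_infinitePi (P := P) (X := fun _ a => a)
    fun _ => measurable_id).indepFun_finset s {i} (by simpa using hi) fun j => by fun_prop
  have heval : Measurable fun r : ∀ j : ({i} : Finset ι), X j => r ⟨i, by simp⟩ :=
    measurable_pi_apply _
  exact hindep.comp measurable_id heval

variable [∀ i, Finite (X i)] [∀ i, DiscreteMeasurableSpace (X i)]
  (P : ∀ i, Measure (X i)) [∀ i, IsProbabilityMeasure (P i)] {G : Type*} [NormedAddCommGroup G]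

theorem integrable_infinitePi_of_dependsOn {f : (∀ i, X i) → G} {s : Finset ι}
    (hf : DependsOn f s) : Integrable f (Measure.infinitePi P) := by
  obtain ⟨g, rfl⟩ := dependsOn_iff_exists_comp.1 hf
  have hg : Integrable g ((Measure.infinitePi P).map s.restrict) := .of_finite
  exact hg.comp_measurable (by fun_prop)

theorem integral_infinitePi_of_dependsOn [NormedSpace ℝ G] {β : Type*} {Y : (∀ i, X i) → β}
    {s : Finset ι} (hY : DependsOn Y s) {i : ι} (hi : i ∉ s) (h : β → X i → G) :
    ∫ ω, h (Y ω) (ω i) ∂Measure.infinitePi P =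
      ∫ ω, ∫ a, h (Y ω) a ∂P i ∂Measure.infinitePi P := by
  obtain ⟨ω₀⟩ : Nonempty (∀ i, X i) := (Measure.infinitePi P).nonempty_of_neZero
  have : Nonempty β := ⟨Y ω₀⟩
  obtain ⟨g, rfl⟩ := dependsOn_iff_exists_comp.1 hY
  have hmap : (Measure.infinitePi P).map (fun ω => (s.restrict ω, ω i)) =
      ((Measure.infinitePi P).map s.restrict).prod (P i) := by
    rw [(ProbabilityTheory.indepFun_iff_map_prod_eq_prod_map_map (by fun_prop)
      (measurable_pi_apply i).aemeasurable).1 (indepFun_restrict_eval_infinitePi P hi)]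
    exact congrArg _ (Measure.infinitePi_map_eval P i)
  have : IsProbabilityMeasure ((Measure.infinitePi P).map s.restrict) :=
    Measure.isProbabilityMeasure_map (by fun_prop)
  calc ∫ ω, h (g (s.restrict ω)) (ω i) ∂Measure.infinitePi P
      = ∫ z, h (g z.1) z.2 ∂(Measure.infinitePi P).map fun ω => (s.restrict ω, ω i) := by
        have hmeas : AEMeasurable (fun ω : ∀ j, X j => (s.restrict ω, ω i))
            (Measure.infinitePi P) := by fun_prop
        rw [integral_map hmeas Integrable.of_finite.aestronglyMeasurable]
    _ = ∫ r, ∫ a, h (g r) a ∂P i ∂(Measure.infinitePi P).map s.restrict := by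
        rw [hmap, integral_prod _ .of_finite]
    _ = ∫ ω, ∫ a, h (g (s.restrict ω)) a ∂P i ∂Measure.infinitePi P := by
        rw [integral_map (by fun_prop) Integrable.of_finite.aestronglyMeasurable]

end InfinitePi

section RandomOrbit

variable {S A : Type*}

/-- The orbit of the random recursion `s ↦ F s a`: the state at each time when the initial state is
`s₀` and the inputs are `ω 0, ω 1, …`. -/
def randomOrbit (F : S → A → S) (s₀ : S) (ω : ℕ → A) : ℕ → S
  | 0 => s₀
  | t + 1 => F (randomOrbit F s₀ ω t) (ω t)

theorem dependsOn_randomOrbit (F : S → A → S) (s₀ : S) (t : ℕ) :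
    DependsOn (randomOrbit F s₀ · t) (Finset.range t) := by
  induction t with
  | zero => exact fun _ _ _ => rfl
  | succ t ih =>
    intro ω ω' h
    simp only [randomOrbit]
    have horbit : randomOrbit F s₀ ω t = randomOrbit F s₀ ω' t :=
      ih fun τ hτ => h τ (by simpa using (Finset.mem_range.1 hτ).trans t.lt_succ_self)
    rw [horbit, h t (by simp)]

variable [Finite A] [MeasurableSpace A] [DiscreteMeasurableSpace A] (ν : Measure A)
  [IsProbabilityMeasure ν]

theorem integrable_randomOrbit (F : S → A → S) (s₀ : S) (t : ℕ) (h : S → A → ℝ) :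
    Integrable (fun ω => h (randomOrbit F s₀ ω t) (ω t)) (Measure.infinitePi fun _ => ν) := by
  refine integrable_infinitePi_of_dependsOn _ (s := Finset.range (t + 1)) fun ω ω' hω => ?_
  have horbit := dependsOn_randomOrbit F s₀ t fun τ hτ =>
    hω τ (by simpa using (Finset.mem_range.1 hτ).trans t.lt_succ_self)
  simp only [horbit, hω t (by simp)]

/-- The transition operator of the Markov chain generated by `F` and independent inputs with law
`ν`, acting on functions of the state. -/
noncomputable def transitionOperator (F : S → A → S) : (S → ℝ) →ₗ[ℝ] (S → ℝ) where
  toFun f s := ∫ a, f (F s a) ∂ν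
  map_add' _ _ := funext fun _ => integral_add .of_finite .of_finite
  map_smul' r _ := funext fun _ => integral_const_mul r _

theorem lipschitzWith_transitionOperator [Fintype S] (F : S → A → S) :
    LipschitzWith 1 (transitionOperator ν F) := by
  refine AddMonoidHomClass.lipschitz_of_bound_nnnorm (transitionOperator ν F) 1 fun f => ?_
  rw [one_mul]
  refine (pi_norm_le_iff_of_nonneg (norm_nonneg f)).2 fun s => ?_
  have hbound := norm_integral_le_of_norm_le_const (μ := ν)
    (.of_forall fun a => norm_le_pi_norm f (F s a))
  simpa [transitionOperator] using hbound

theorem integral_randomOrbit (F : S → A → S) (s₀ : S) (t : ℕ) (f : S → ℝ) :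
    ∫ ω, f (randomOrbit F s₀ ω t) ∂(Measure.infinitePi fun _ => ν) =
      (transitionOperator ν F)^[t] f s₀ := by
  induction t generalizing f with
  | zero => simp [randomOrbit]
  | succ t ih =>
    rw [Function.iterate_succ_apply, ← ih]
    exact integral_infinitePi_of_dependsOn _ (dependsOn_randomOrbit F s₀ t) (by simp)
      fun s a => f (F s a)

/-- `π` is a stationary distribution of the Markov chain generated by `F` and independent inputs
with law `ν`. Invariance is stated in its weak form, tested against all functions of the state. -/
structure IsStationaryDistribution [Fintype S] (F : S → A → S) (π : S → ℝ) : Prop where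
  mem_stdSimplex : π ∈ stdSimplex ℝ S
  dotProduct_transitionOperator : ∀ f, π ⬝ᵥ transitionOperator ν F f = π ⬝ᵥ f

/-- Average, over the first `t` periods, of the mean of `h` at the current state and input. -/
noncomputable def meanTimeAverage (F : S → A → S) (s₀ : S) (h : S → A → ℝ) (t : ℕ) : ℝ :=
  (t : ℝ)⁻¹ * ∑ τ ∈ Finset.range t,
    ∫ ω, h (randomOrbit F s₀ ω τ) (ω τ) ∂(Measure.infinitePi fun _ => ν)

theorem meanTimeAverage_eq_birkhoffAverage (F : S → A → S) (s₀ : S) (h : S → A → ℝ) (t : ℕ) :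
    meanTimeAverage ν F s₀ h t =
      birkhoffAverage ℝ (transitionOperator ν F) id t (fun s => ∫ a, h s a ∂ν) s₀ := by
  simp only [meanTimeAverage, birkhoffAverage, birkhoffSum, Pi.smul_apply, Finset.sum_apply,
    smul_eq_mul, id]
  congr 1
  refine Finset.sum_congr rfl fun τ _ => ?_
  rw [← integral_randomOrbit]
  exact integral_infinitePi_of_dependsOn _ (dependsOn_randomOrbit F s₀ τ) (by simp) h

theorem exists_isStationaryDistribution_tendsto_meanTimeAverage [Fintype S] (F : S → A → S)
    (s₀ : S) :
    ∃ π, IsStationaryDistribution ν F π ∧ ∀ h : S → A → ℝ,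
      Tendsto (meanTimeAverage ν F s₀ h) atTop (𝓝 (π ⬝ᵥ fun s => ∫ a, h s a ∂ν)) := by
  obtain ⟨P, hP, hinv⟩ := exists_tendsto_birkhoffAverage (lipschitzWith_transitionOperator ν F)
  let L : (S → ℝ) →ₗ[ℝ] ℝ := LinearMap.proj s₀ ∘ₗ P
  have hL : ∀ h : S → A → ℝ,
      Tendsto (meanTimeAverage ν F s₀ h) atTop (𝓝 (L fun s => ∫ a, h s a ∂ν)) := fun h =>
    (tendsto_pi_nhds.1 (hP _) s₀).congr fun t =>
      (meanTimeAverage_eq_birkhoffAverage ν F s₀ h t).symm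
  have hLstate : ∀ f : S → ℝ,
      Tendsto (meanTimeAverage ν F s₀ fun s _ => f s) atTop (𝓝 (L f)) := fun f => by
    simpa using hL fun s _ => f s
  have hnonneg : ∀ f, 0 ≤ f → 0 ≤ L f := fun f hf => ge_of_tendsto' (hLstate f) fun t =>
    mul_nonneg (by positivity) (Finset.sum_nonneg fun τ _ => integral_nonneg fun ω => hf _)
  have hone : L 1 = 1 := by
    refine tendsto_nhds_unique (hLstate 1) (tendsto_const_nhds.congr' ?_)
    filter_upwards [eventually_ne_atTop 0] with t ht
    simp [meanTimeAverage, ht]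
  obtain ⟨π, hπ, hLπ⟩ := exists_mem_stdSimplex_forall_eq_dotProduct hnonneg hone
  refine ⟨π, ⟨hπ, fun f => ?_⟩, fun h => hLπ _ ▸ hL h⟩
  rw [← hLπ, ← hLπ]
  exact congrFun (hinv f) s₀

end RandomOrbit

section SummationByParts

theorem sum_Icc_sub_mul_add {R : Type*} [CommRing R] (y w : ℤ → R) {a b : ℤ} (hab : a ≤ b) :
    ∑ u ∈ Finset.Icc (a + 1) b, (y (u - 1) - y u) * w u + y b * w (b + 1) =
      y a * w a + ∑ u ∈ Finset.Icc a b, y u * (w (u + 1) - w u) := by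
  induction b, hab using Int.leInduction with
  | base => simp [mul_sub]
  | succ b hab ih =>
    rw [← Finset.insert_Icc_right_eq_Icc_add_one (by omega),
      ← Finset.insert_Icc_right_eq_Icc_add_one (by omega), Finset.sum_insert (by simp),
      Finset.sum_insert (by simp), add_sub_cancel_right]
    linear_combination ih

-- Of the `y (u - 1)` riders, `y (u - 1) - y u` stop at `u`, after travelling `max u 0`: paying `c`
-- per unit of distance at the stop is the same as paying it period by period.
theorem sum_Icc_sub_mul_sub_mul_max {R : Type*} [CommRing R] (y : ℤ → R) (p c : R) {a b : ℤ}
    (ha : a ≤ 0) (hb : 0 ≤ b) :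
    ∑ u ∈ Finset.Icc (a + 1) b, (y (u - 1) - y u) * (p - c * ((max u 0 : ℤ) : R)) +
        y b * (p - c * ((b + 1 : ℤ) : R)) =
      p * y a - ∑ u ∈ Finset.Icc 0 b, c * y u := by
  have hparts := sum_Icc_sub_mul_add y (fun u => p - c * ((max u 0 : ℤ) : R)) (ha.trans hb)
  have hstep : ∑ u ∈ Finset.Icc a b, y u * ((p - c * ((max (u + 1) 0 : ℤ) : R)) -
      (p - c * ((max u 0 : ℤ) : R))) = -∑ u ∈ Finset.Icc 0 b, c * y u := by
    rw [← Finset.sum_neg_distrib]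
    symm
    refine Finset.sum_subset_zero_on_sdiff (Finset.Icc_subset_Icc_left ha) ?_ ?_
    · intro u hu
      have hu' : u < 0 := by
        rw [Finset.mem_sdiff, Finset.mem_Icc, Finset.mem_Icc] at hu
        omega
      simp [max_eq_right hu'.le, max_eq_right (show u + 1 ≤ 0 by omega)]
    · intro u hu
      have hu' : 0 ≤ u := (Finset.mem_Icc.1 hu).1
      rw [max_eq_left hu', max_eq_left (by omega)]
      push_cast
      ring
  rw [hstep, max_eq_left (by omega), max_eq_right ha] at hparts
  rw [hparts, Int.cast_zero]
  ring

end SummationByParts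

namespace RideModel

variable {N : ℕ} {M : RideModel N}

section Chain

instance instDiscreteMeasurableSpaceRequest : DiscreteMeasurableSpace (Request N) :=
  ⟨fun _ => trivial⟩

theorem integral_requestLaw_ite_eq_some (lam : M.PricingPolicy) (i : Fin N) (r : ℝ) :
    ∫ a, (if a = some i then r else 0) ∂M.requestLaw lam = M.rate lam i * r := by
  have hreal : (M.requestLaw lam).real {some i} = M.rate lam i := by
    rw [measureReal_def, ← ENNReal.toReal_ofReal (M.rate_nonneg lam i)]
    simp [requestLaw, Set.indicator_apply]
  have hind : (fun a : Request N => if a = some i then r else 0) =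
      Set.indicator {some i} fun _ => r := by
    ext a
    simp [Set.indicator_apply]
  rw [hind, integral_indicator_const r .of_discrete, hreal, smul_eq_mul]

variable (M) in
/-- The states of the Markov chain: the sets of occupied solo states. -/
abbrev ProperState : Type := M.soloStates.powerset

theorem step_subset (φ : M.MatchingPolicy) (s : SystemState N) (a : Request N) :
    step φ s a ⊆ M.soloStates := fun _ hq => (Finset.mem_filter.1 hq).2

/-- The step of the system, as a map of the finite state space `ProperState M`. -/
noncomputable def properStep (φ : M.MatchingPolicy) (s : M.ProperState) (a : Request N) :
    M.ProperState :=
  ⟨step φ s a, Finset.mem_powerset.2 (step_subset φ s a)⟩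

theorem coe_randomOrbit_properStep (φ : M.MatchingPolicy) (s₀ : M.ProperState)
    (ω : ℕ → Request N) (t : ℕ) :
    ((randomOrbit (properStep φ) s₀ ω t : M.ProperState) : SystemState N) = stateAt φ s₀ ω t := by
  induction t with
  | zero => rfl
  | succ t ih => simp only [randomOrbit, properStep, stateAt, ih]

theorem mem_step_iff (φ : M.MatchingPolicy) {j : Fin N} {u : ℤ} (hu : (j, u) ∈ M.soloStates)
    (s : SystemState N) (a : Request N) :
    (j, u) ∈ step φ s a ↔ (j, u - 1) ∈ remaining φ s a := by
  simp only [step, Finset.mem_filter, Finset.mem_image, hu, and_true, Prod.exists, Prod.mk.injEq]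
  constructor
  · rintro ⟨_, v, hv, rfl, rfl⟩
    rwa [add_sub_cancel_right]
  · exact fun h => ⟨j, u - 1, h, rfl, sub_add_cancel u 1⟩

end Chain

section OnePeriod

variable (φ : M.MatchingPolicy)

/-- Indicator of a match of a new rider of type `i` with a solo rider in state `q`. -/
noncomputable def matchIndicator (i : Fin N) (q : Fin N × ℤ) (s : SystemState N) (a : Request N) :
    ℝ :=
  if a = some i ∧ φ.act i s = some q then 1 else 0

/-- Indicator of a rider in state `q` who continues alone. -/
noncomputable def soloIndicator (q : Fin N × ℤ) (s : SystemState N) (a : Request N) : ℝ :=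
  if q ∈ remaining φ s a then 1 else 0

theorem remaining_none (s : SystemState N) : remaining φ s none = s := rfl

theorem remaining_of_act_eq_none {i : Fin N} {s : SystemState N} (h : φ.act i s = none) :
    remaining φ s (some i) = insert (i, -(M.T : ℤ)) s := by
  simp only [remaining, h]

theorem remaining_of_act_eq_some {i : Fin N} {s : SystemState N} {q : Fin N × ℤ}
    (h : φ.act i s = some q) : remaining φ s (some i) = s.erase q := by
  simp only [remaining, h]

theorem sum_matchIndicator_add_soloIndicator {q : Fin N × ℤ} (hq : q ∈ M.soloStates)
    (s : SystemState N) (a : Request N) :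
    ∑ i ∈ M.compat q, matchIndicator φ i q s a + soloIndicator φ q s a =
      if q ∈ s then 1 else 0 := by
  obtain _ | i := a
  · rw [soloIndicator, remaining_none]
    simp [matchIndicator]
  have hsum : ∑ k ∈ M.compat q, matchIndicator φ k q s (some i) =
      if φ.act i s = some q then 1 else 0 := by
    simp only [matchIndicator, Option.some_inj, ite_and, Finset.sum_ite_eq]
    exact ite_eq_left_iff.2 fun hi => (if_neg fun h => hi (φ.admissible i s q h).2).symm
  rw [hsum, soloIndicator]
  cases hact : φ.act i s with
  | none =>
    have hne : q ≠ (i, -(M.T : ℤ)) := by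
      rintro rfl
      have := ((M.mem_soloStates _ _).1 hq).1
      omega
    simp [remaining_of_act_eq_none φ hact, hne]
  | some r =>
    have hr := (φ.admissible i s r hact).1
    rw [remaining_of_act_eq_some φ hact]
    by_cases hrq : r = q
    · simp [hrq, hrq ▸ hr]
    · simp [hrq, Ne.symm hrq]

theorem sum_matchIndicator_add_soloIndicator_origin (i : Fin N) {s : SystemState N}
    (hs : s ⊆ M.soloStates) (a : Request N) :
    ∑ q ∈ M.soloStates with i ∈ M.compat q, matchIndicator φ i q s a +
      soloIndicator φ (i, -(M.T : ℤ)) s a = if a = some i then 1 else 0 := by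
  have hnew : (i, -(M.T : ℤ)) ∉ s := fun h => by
    have := ((M.mem_soloStates _ _).1 (hs h)).1
    omega
  obtain _ | k := a
  · simp [matchIndicator, soloIndicator, remaining_none, hnew]
  unfold matchIndicator soloIndicator
  cases hact : φ.act k s with
  | none =>
    rw [remaining_of_act_eq_none φ hact]
    by_cases hk : k = i
    · simp [← hk, hact]
    · simp [hk, hnew, Ne.symm hk]
  | some r =>
    obtain ⟨hr, hcompat⟩ := φ.admissible k s r hact
    rw [remaining_of_act_eq_some φ hact]
    by_cases hk : k = i
    · simp [← hk, hact, hcompat, hs hr, hk ▸ hnew]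
    · simp [hk, hnew]

/-- Probability that a period which starts in state `s` brings a match of a new rider of type `i`
with a solo rider in state `q`. -/
noncomputable def matchProb (lam : M.PricingPolicy) (i : Fin N) (q : Fin N × ℤ)
    (s : SystemState N) : ℝ :=
  ∫ a, matchIndicator φ i q s a ∂M.requestLaw lam

/-- Probability that, after the decision of a period which starts in state `s`, there is a rider in
state `q` who continues alone. -/
noncomputable def soloProb (lam : M.PricingPolicy) (q : Fin N × ℤ) (s : SystemState N) : ℝ :=
  ∫ a, soloIndicator φ q s a ∂M.requestLaw lam

theorem matchProb_eq (lam : M.PricingPolicy) (i : Fin N) (q : Fin N × ℤ) (s : SystemState N) :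
    matchProb φ lam i q s = M.rate lam i * if φ.act i s = some q then 1 else 0 := by
  simp only [matchProb, matchIndicator, ite_and, integral_requestLaw_ite_eq_some]

theorem matchProb_nonneg (lam : M.PricingPolicy) (i : Fin N) (q : Fin N × ℤ) (s : SystemState N) :
    0 ≤ matchProb φ lam i q s := by
  rw [matchProb_eq]
  exact mul_nonneg (M.rate_nonneg lam i) (by split_ifs <;> norm_num)

theorem matchProb_le_rate (lam : M.PricingPolicy) (i : Fin N) (q : Fin N × ℤ)
    (s : SystemState N) : matchProb φ lam i q s ≤ M.rate lam i := by
  rw [matchProb_eq]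
  exact mul_le_of_le_one_right (M.rate_nonneg lam i) (by split_ifs <;> norm_num)

theorem matchProb_eq_zero (lam : M.PricingPolicy) {i : Fin N} {q : Fin N × ℤ}
    (h : i ∉ M.compat q) (s : SystemState N) : matchProb φ lam i q s = 0 := by
  rw [matchProb_eq, if_neg fun hact => h (φ.admissible i s q hact).2, mul_zero]

theorem soloProb_nonneg (lam : M.PricingPolicy) (q : Fin N × ℤ) (s : SystemState N) :
    0 ≤ soloProb φ lam q s :=
  integral_nonneg fun a => by
    unfold soloIndicator
    split_ifs <;> norm_num

theorem sum_matchProb_add_soloProb (lam : M.PricingPolicy) {q : Fin N × ℤ}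
    (hq : q ∈ M.soloStates) (s : SystemState N) :
    ∑ i ∈ M.compat q, matchProb φ lam i q s + soloProb φ lam q s = if q ∈ s then 1 else 0 := by
  simp only [matchProb, soloProb]
  rw [← integral_finsetSum _ fun _ _ => .of_finite, ← integral_add .of_finite .of_finite]
  simp only [sum_matchIndicator_add_soloIndicator φ hq, integral_const, probReal_univ, one_smul]

theorem sum_matchProb_add_soloProb_origin (lam : M.PricingPolicy) (i : Fin N) {s : SystemState N}
    (hs : s ⊆ M.soloStates) :
    ∑ q ∈ M.soloStates with i ∈ M.compat q, matchProb φ lam i q s +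
      soloProb φ lam (i, -(M.T : ℤ)) s = M.rate lam i := by
  simp only [matchProb, soloProb]
  rw [← integral_finsetSum _ fun _ _ => .of_finite, ← integral_add .of_finite .of_finite]
  simp only [sum_matchIndicator_add_soloIndicator_origin φ i hs, integral_requestLaw_ite_eq_some,
    mul_one]

theorem one_sub_sum_rate_le_soloProb (lam : M.PricingPolicy) {q : Fin N × ℤ}
    (hq : q ∈ M.soloStates) {s : SystemState N} (hs : q ∈ s) :
    1 - ∑ i ∈ M.compat q, M.rate lam i ≤ soloProb φ lam q s := by
  have hbalance := sum_matchProb_add_soloProb φ lam hq s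
  rw [if_pos hs] at hbalance
  have hle : ∑ i ∈ M.compat q, matchProb φ lam i q s ≤ ∑ i ∈ M.compat q, M.rate lam i :=
    Finset.sum_le_sum fun i _ => matchProb_le_rate φ lam i q s
  linarith

theorem one_sub_sum_rate_mul_matchProb_le (lam : M.PricingPolicy) (i : Fin N) {q : Fin N × ℤ}
    (hq : q ∈ M.soloStates) (s : SystemState N) :
    (1 - ∑ k ∈ M.compat q, M.rate lam k) * matchProb φ lam i q s ≤
      M.rate lam i * soloProb φ lam q s := by
  rw [matchProb_eq]
  by_cases hact : φ.act i s = some q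
  · rw [if_pos hact, mul_one, mul_comm]
    exact mul_le_mul_of_nonneg_left
      (one_sub_sum_rate_le_soloProb φ lam hq (φ.admissible i s q hact).1) (M.rate_nonneg lam i)
  · rw [if_neg hact, mul_zero, mul_zero]
    exact mul_nonneg (M.rate_nonneg lam i) (soloProb_nonneg φ lam q s)

end OnePeriod

section StationaryFlow

variable (φ : M.MatchingPolicy)

/-- Frequency of the matches of new riders of type `i` with solo riders in state `q`, when the
states of the system have distribution `π`. -/
noncomputable def matchFlow (lam : M.PricingPolicy) (π : M.ProperState → ℝ) (i : Fin N)
    (q : Fin N × ℤ) : ℝ :=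
  π ⬝ᵥ fun s => matchProb φ lam i q s

/-- Frequency of the periods after whose decision a rider in state `(j, u)` continues alone, when
the states of the system have distribution `π`. -/
noncomputable def soloFlow (lam : M.PricingPolicy) (π : M.ProperState → ℝ) (j : Fin N) (u : ℤ) :
    ℝ :=
  π ⬝ᵥ fun s => soloProb φ lam (j, u) s

theorem sum_matchFlow_add_soloFlow (lam : M.PricingPolicy) (π : M.ProperState → ℝ) {j : Fin N}
    {u : ℤ} (hu : (j, u) ∈ M.soloStates) :
    ∑ i ∈ M.compat (j, u), matchFlow φ lam π i (j, u) + soloFlow φ lam π j u =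
      π ⬝ᵥ fun s => if (j, u) ∈ s.1 then 1 else 0 := by
  simp only [matchFlow, soloFlow, ← dotProduct_sum, ← dotProduct_add]
  congr 1
  ext s
  rw [← sum_matchProb_add_soloProb φ lam hu, Pi.add_apply, Finset.sum_apply]

theorem sum_matchFlow_add_soloFlow_origin (lam : M.PricingPolicy) {π : M.ProperState → ℝ}
    (hπ : π ∈ stdSimplex ℝ M.ProperState) (i : Fin N) :
    ∑ q ∈ M.soloStates with i ∈ M.compat q, matchFlow φ lam π i q +
      soloFlow φ lam π i (-(M.T : ℤ)) = M.rate lam i := by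
  have hconst : π ⬝ᵥ (fun _ => M.rate lam i) = M.rate lam i := by
    rw [dotProduct, ← Finset.sum_mul, hπ.2, one_mul]
  simp only [matchFlow, soloFlow, ← dotProduct_sum, ← dotProduct_add]
  refine .trans ?_ hconst
  congr 1
  ext s
  rw [← sum_matchProb_add_soloProb_origin φ lam i (Finset.mem_powerset.1 s.2), Pi.add_apply,
    Finset.sum_apply]

variable {φ} {lam : M.PricingPolicy} {π : M.ProperState → ℝ}

theorem dotProduct_ite_mem_eq_soloFlow
    (hπ : IsStationaryDistribution (M.requestLaw lam) (properStep φ) π) {j : Fin N} {u : ℤ}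
    (hu : (j, u) ∈ M.soloStates) :
    (π ⬝ᵥ fun s => if (j, u) ∈ s.1 then 1 else 0) = soloFlow φ lam π j (u - 1) := by
  rw [← hπ.dotProduct_transitionOperator]
  congr 1
  ext s
  change ∫ a, (if (j, u) ∈ step φ s a then (1 : ℝ) else 0) ∂M.requestLaw lam = _
  simp only [mem_step_iff φ hu, soloProb, soloIndicator]

theorem isFluidFeasible_of_isStationaryDistribution
    (hπ : IsStationaryDistribution (M.requestLaw lam) (properStep φ) π) :
    M.IsFluidFeasible lam (matchFlow φ lam π) (soloFlow φ lam π) where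
  demand i := sum_matchFlow_add_soloFlow_origin φ lam hπ.mem_stdSimplex i
  balance j u hu := by
    rw [sum_matchFlow_add_soloFlow φ lam π hu, dotProduct_ite_mem_eq_soloFlow hπ hu]
  ratio j u hu i _ := by
    simp only [matchFlow, soloFlow, ← smul_eq_mul, ← dotProduct_smul]
    exact dotProduct_le_dotProduct_of_nonneg_left
      (fun s => one_sub_sum_rate_mul_matchProb_le φ lam i hu s) hπ.mem_stdSimplex.1
  x_nonneg j u _ i _ := dotProduct_nonneg_of_nonneg hπ.mem_stdSimplex.1 fun s =>
    matchProb_nonneg φ lam i (j, u) s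
  y_nonneg i u _ _ := dotProduct_nonneg_of_nonneg hπ.mem_stdSimplex.1 fun s =>
    soloProb_nonneg φ lam (i, u) s

end StationaryFlow

section FluidProfit

theorem sum_soloStates (f : Fin N × ℤ → ℝ) :
    ∑ q ∈ M.soloStates, f q =
      ∑ j, ∑ u ∈ Finset.Icc (-(M.T : ℤ) + 1) ((M.ℓ j : ℤ) - 1), f (j, u) :=
  Finset.sum_finset_product' _ _ _ (f := fun j u => f (j, u)) fun q => by
    simpa using M.mem_soloStates q.1 q.2

variable {lam : M.PricingPolicy} {x : Fin N → Fin N × ℤ → ℝ} {y : Fin N → ℤ → ℝ}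

theorem IsFluidFeasible.sum_mul_eq (h : M.IsFluidFeasible lam x y) (w : Fin N × ℤ → ℝ) :
    ∑ i, ∑ q ∈ M.soloStates with i ∈ M.compat q, x i q * w q =
      ∑ j, ∑ u ∈ Finset.Icc (-(M.T : ℤ) + 1) ((M.ℓ j : ℤ) - 1),
        (y j (u - 1) - y j u) * w (j, u) := by
  have hswap : ∑ i, ∑ q ∈ M.soloStates with i ∈ M.compat q, x i q * w q =
      ∑ q ∈ M.soloStates, ∑ i ∈ M.compat q, x i q * w q :=
    Finset.sum_comm' fun i q => by simp [and_comm]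
  rw [hswap, sum_soloStates]
  refine Finset.sum_congr rfl fun j _ => Finset.sum_congr rfl fun u hu => ?_
  rw [← Finset.sum_mul, ← h.balance j u ((M.mem_soloStates j u).2 (Finset.mem_Icc.1 hu)),
    add_sub_cancel_right]

theorem IsFluidFeasible.sum_solo_add_sum_matched (h : M.IsFluidFeasible lam x y) (p : Fin N → ℝ) :
    ∑ i, y i ((M.ℓ i : ℤ) - 1) * (p i - M.c * M.ℓ i) +
      ∑ i, ∑ q ∈ M.soloStates with i ∈ M.compat q,
        x i q * (p q.1 - M.c * ((max q.2 0 : ℤ) : ℝ)) =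
      ∑ i, p i * y i (-(M.T : ℤ)) -
        ∑ i, ∑ u ∈ Finset.Icc (0 : ℤ) ((M.ℓ i : ℤ) - 1), M.c * y i u := by
  rw [h.sum_mul_eq fun q => p q.1 - M.c * ((max q.2 0 : ℤ) : ℝ), ← Finset.sum_add_distrib,
    ← Finset.sum_sub_distrib]
  refine Finset.sum_congr rfl fun i _ => ?_
  have hℓ := M.ℓ_pos i
  rw [← sum_Icc_sub_mul_sub_mul_max (y i) (p i) M.c (by omega) (by omega), add_comm]
  simp

theorem IsFluidFeasible.profit_eq (h : M.IsFluidFeasible lam x y) (p : Fin N → ℝ) :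
    ∑ i, y i ((M.ℓ i : ℤ) - 1) * (p i - M.c * M.ℓ i) +
      ∑ i, ∑ q ∈ M.soloStates with i ∈ M.compat q, x i q *
        (p i + p q.1 - M.c * ((max q.2 0 : ℤ) : ℝ) - M.c * M.sharedLen i q) =
      ∑ i, M.rate lam i * p i - M.flowCost x y := by
  have hsplit : ∑ i, ∑ q ∈ M.soloStates with i ∈ M.compat q, x i q *
        (p i + p q.1 - M.c * ((max q.2 0 : ℤ) : ℝ) - M.c * M.sharedLen i q) =
      ∑ i, (∑ q ∈ M.soloStates with i ∈ M.compat q, x i q) * p i +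
      ∑ i, ∑ q ∈ M.soloStates with i ∈ M.compat q,
        x i q * (p q.1 - M.c * ((max q.2 0 : ℤ) : ℝ)) -
      ∑ i, ∑ q ∈ M.soloStates with i ∈ M.compat q, M.c * M.sharedLen i q * x i q := by
    simp only [Finset.sum_mul, ← Finset.sum_add_distrib, ← Finset.sum_sub_distrib]
    exact Finset.sum_congr rfl fun i _ => Finset.sum_congr rfl fun q _ => by ring
  have hdemand : ∑ i, M.rate lam i * p i =
      ∑ i, (∑ q ∈ M.soloStates with i ∈ M.compat q, x i q) * p i +
      ∑ i, p i * y i (-(M.T : ℤ)) := by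
    rw [← Finset.sum_add_distrib]
    exact Finset.sum_congr rfl fun i _ => by rw [← h.demand i]; ring
  rw [hsplit, hdemand, flowCost]
  linear_combination h.sum_solo_add_sum_matched p

end FluidProfit

section Profit

variable (φ : M.MatchingPolicy) (lam : M.PricingPolicy)

/-- Profit of one period, as a function of the state and the request. -/
noncomputable def periodProfit (s : SystemState N) (a : Request N) : ℝ :=
  ∑ i, soloIndicator φ (i, (M.ℓ i : ℤ) - 1) s a * (M.price i (lam i) - M.c * M.ℓ i) +
    ∑ i, ∑ q ∈ M.soloStates, matchIndicator φ i q s a *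
      (M.price i (lam i) + M.price q.1 (lam q.1)
        - M.c * ((max q.2 0 : ℤ) : ℝ) - M.c * M.sharedLen i q)

theorem totalProfit_eq_sum (s₀ : SystemState N) (t : ℕ) (ω : ℕ → Request N) :
    totalProfit lam φ s₀ t ω =
      ∑ τ ∈ Finset.range t, periodProfit φ lam (stateAt φ s₀ ω τ) (ω τ) := by
  have hsolo : ∀ i, (soloCount φ s₀ ω t i : ℝ) = ∑ τ ∈ Finset.range t,
      soloIndicator φ (i, (M.ℓ i : ℤ) - 1) (stateAt φ s₀ ω τ) (ω τ) := fun i => by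
    simp [soloCount, soloIndicator]
  have hmatch : ∀ i q, (matchCount φ s₀ ω t i q : ℝ) = ∑ τ ∈ Finset.range t,
      matchIndicator φ i q (stateAt φ s₀ ω τ) (ω τ) := fun i q => by
    simp [matchCount, matchIndicator]
  simp only [totalProfit, periodProfit, hsolo, hmatch, Finset.sum_mul, Finset.sum_add_distrib]
  congr 1
  · exact Finset.sum_comm
  · simp only [Finset.sum_comm (s := Finset.range t)]

theorem averageProfit_eq_meanTimeAverage (s₀ : M.ProperState) :
    averageProfit lam φ s₀ =
      meanTimeAverage (M.requestLaw lam) (properStep φ) s₀ fun s => periodProfit φ lam s := by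
  ext t
  simp only [averageProfit, meanTimeAverage, totalProfit_eq_sum, one_div, processLaw,
    ← coe_randomOrbit_properStep]
  rw [integral_finsetSum _ fun τ _ =>
    integrable_randomOrbit _ _ s₀ τ fun s => periodProfit φ lam s]

theorem integral_periodProfit (s : SystemState N) :
    ∫ a, periodProfit φ lam s a ∂M.requestLaw lam =
      ∑ i, soloProb φ lam (i, (M.ℓ i : ℤ) - 1) s * (M.price i (lam i) - M.c * M.ℓ i) +
        ∑ i, ∑ q ∈ M.soloStates with i ∈ M.compat q, matchProb φ lam i q s *
          (M.price i (lam i) + M.price q.1 (lam q.1)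
            - M.c * ((max q.2 0 : ℤ) : ℝ) - M.c * M.sharedLen i q) := by
  simp only [periodProfit]
  rw [integral_add .of_finite .of_finite, integral_finsetSum _ fun _ _ => .of_finite,
    integral_finsetSum _ fun _ _ => .of_finite]
  simp only [integral_mul_const, soloProb]
  congr 1
  refine Finset.sum_congr rfl fun i _ => ?_
  rw [integral_finsetSum _ fun _ _ => .of_finite, Finset.sum_filter_of_ne fun q _ hne => ?_]
  · simp only [integral_mul_const, matchProb]
  · contrapose! hne
    rw [matchProb_eq_zero φ lam hne, zero_mul]

theorem dotProduct_integral_periodProfit (π : M.ProperState → ℝ) :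
    (π ⬝ᵥ fun s => ∫ a, periodProfit φ lam s a ∂M.requestLaw lam) =
      ∑ i, soloFlow φ lam π i ((M.ℓ i : ℤ) - 1) * (M.price i (lam i) - M.c * M.ℓ i) +
        ∑ i, ∑ q ∈ M.soloStates with i ∈ M.compat q, matchFlow φ lam π i q *
          (M.price i (lam i) + M.price q.1 (lam q.1)
            - M.c * ((max q.2 0 : ℤ) : ℝ) - M.c * M.sharedLen i q) := by
  simp only [integral_periodProfit, soloFlow, matchFlow, dotProduct, mul_add, Finset.mul_sum,
    Finset.sum_add_distrib, Finset.sum_mul, mul_assoc,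
    Finset.sum_comm (s := (Finset.univ : Finset M.ProperState))]

theorem exists_isFluidFeasible_tendsto_averageProfit {s₀ : SystemState N}
    (hs₀ : s₀ ⊆ M.soloStates) :
    ∃ x y, M.IsFluidFeasible lam x y ∧ Tendsto (averageProfit lam φ s₀) atTop
      (𝓝 (∑ i, M.rate lam i * M.price i (lam i) - M.flowCost x y)) := by
  let s₁ : M.ProperState := ⟨s₀, Finset.mem_powerset.2 hs₀⟩
  obtain ⟨π, hπ, hlim⟩ := exists_isStationaryDistribution_tendsto_meanTimeAverage
    (M.requestLaw lam) (properStep φ) s₁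
  have hfeasible := isFluidFeasible_of_isStationaryDistribution hπ
  refine ⟨_, _, hfeasible, ?_⟩
  rw [← hfeasible.profit_eq, ← dotProduct_integral_periodProfit]
  change Tendsto (averageProfit lam φ s₁) atTop _
  rw [averageProfit_eq_meanTimeAverage]
  exact hlim _

end Profit

section LinearProgram

theorem isFluidFeasible_unmatched (lam : M.PricingPolicy) :
    M.IsFluidFeasible lam (fun _ _ => 0) (fun i _ => M.rate lam i) where
  demand i := by simp
  balance j u _ := by simp
  ratio j u _ i _ := by simpa using mul_nonneg (M.rate_nonneg lam i) (M.rate_nonneg lam j)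
  x_nonneg _ _ _ _ _ := le_rfl
  y_nonneg i _ _ _ := M.rate_nonneg lam i

variable {lam : M.PricingPolicy} {x x' : Fin N → Fin N × ℤ → ℝ} {y y' : Fin N → ℤ → ℝ}

theorem IsFluidFeasible.x_le_rate (h : M.IsFluidFeasible lam x y) {i : Fin N} {q : Fin N × ℤ}
    (hq : q ∈ M.soloStates) (hi : i ∈ M.compat q) : x i q ≤ M.rate lam i := by
  have hℓ := M.ℓ_pos i
  have hterm : x i q ≤ ∑ r ∈ M.soloStates with i ∈ M.compat r, x i r :=
    Finset.single_le_sum (f := x i)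
      (fun r hr => h.x_nonneg r.1 r.2 (Finset.mem_filter.1 hr).1 i (Finset.mem_filter.1 hr).2)
      (Finset.mem_filter.2 ⟨hq, hi⟩)
  linarith [h.demand i, h.y_nonneg i (-(M.T : ℤ)) le_rfl (by omega)]

theorem IsFluidFeasible.y_le_rate (h : M.IsFluidFeasible lam x y) (i : Fin N) {u : ℤ}
    (hu : -(M.T : ℤ) ≤ u) (huℓ : u ≤ (M.ℓ i : ℤ) - 1) : y i u ≤ M.rate lam i := by
  induction u, hu using Int.leInduction with
  | base =>
    have hmatched : 0 ≤ ∑ q ∈ M.soloStates with i ∈ M.compat q, x i q :=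
      Finset.sum_nonneg fun r hr =>
        h.x_nonneg r.1 r.2 (Finset.mem_filter.1 hr).1 i (Finset.mem_filter.1 hr).2
    linarith [h.demand i]
  | succ u hu ih =>
    have hmem : (i, u + 1) ∈ M.soloStates := (M.mem_soloStates _ _).2 ⟨by omega, huℓ⟩
    have hmatched : 0 ≤ ∑ k ∈ M.compat (i, u + 1), x k (i, u + 1) :=
      Finset.sum_nonneg fun k hk => h.x_nonneg i (u + 1) hmem k hk
    have hbalance := h.balance i (u + 1) hmem
    rw [add_sub_cancel_right] at hbalance
    linarith [ih (by omega)]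

theorem IsFluidFeasible.congr (h : M.IsFluidFeasible lam x y)
    (hx : ∀ i, ∀ q ∈ M.soloStates, i ∈ M.compat q → x' i q = x i q)
    (hy : ∀ i u, -(M.T : ℤ) ≤ u → u ≤ (M.ℓ i : ℤ) - 1 → y' i u = y i u) :
    M.IsFluidFeasible lam x' y' where
  demand i := by
    have hℓ := M.ℓ_pos i
    rw [← h.demand i, hy i _ le_rfl (by omega), Finset.sum_congr rfl fun q hq =>
      hx i q (Finset.mem_filter.1 hq).1 (Finset.mem_filter.1 hq).2]
  balance j u hu := by
    have hbounds := (M.mem_soloStates j u).1 hu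
    rw [hy j u (by omega) hbounds.2, hy j (u - 1) (by omega) (by omega), ← h.balance j u hu,
      Finset.sum_congr rfl fun i hi => hx i _ hu hi]
  ratio j u hu i hi := by
    have hbounds := (M.mem_soloStates j u).1 hu
    rw [hy j u (by omega) hbounds.2, hx i _ hu hi]
    exact h.ratio j u hu i hi
  x_nonneg j u hu i hi := by
    rw [hx i _ hu hi]
    exact h.x_nonneg j u hu i hi
  y_nonneg i u hu huℓ := by
    rw [hy i u hu huℓ]
    exact h.y_nonneg i u hu huℓ

theorem flowCost_congr (hx : ∀ i, ∀ q ∈ M.soloStates, i ∈ M.compat q → x' i q = x i q)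
    (hy : ∀ i u, -(M.T : ℤ) ≤ u → u ≤ (M.ℓ i : ℤ) - 1 → y' i u = y i u) :
    M.flowCost x' y' = M.flowCost x y := by
  refine congrArg₂ (· + ·) (Finset.sum_congr rfl fun i _ => Finset.sum_congr rfl fun u hu => ?_)
    (Finset.sum_congr rfl fun i _ => Finset.sum_congr rfl fun q hq => ?_)
  · have hbounds := Finset.mem_Icc.1 hu
    rw [hy i u (by omega) hbounds.2]
  · rw [hx i q (Finset.mem_filter.1 hq).1 (Finset.mem_filter.1 hq).2]

theorem IsFluidFeasible.exists_mem_Icc (h : M.IsFluidFeasible lam x y) :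
    ∃ z ∈ Set.Icc (0 : (Fin N → Fin N × ℤ → ℝ) × (Fin N → ℤ → ℝ))
        (fun i _ => M.rate lam i, fun i _ => M.rate lam i),
      M.IsFluidFeasible lam z.1 z.2 ∧ M.flowCost z.1 z.2 = M.flowCost x y := by
  let x' : Fin N → Fin N × ℤ → ℝ := fun i q =>
    if q ∈ M.soloStates ∧ i ∈ M.compat q then x i q else 0
  let y' : Fin N → ℤ → ℝ := fun i u =>
    if -(M.T : ℤ) ≤ u ∧ u ≤ (M.ℓ i : ℤ) - 1 then y i u else 0
  have hx : ∀ i, ∀ q ∈ M.soloStates, i ∈ M.compat q → x' i q = x i q := fun i q hq hi =>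
    if_pos ⟨hq, hi⟩
  have hy : ∀ i u, -(M.T : ℤ) ≤ u → u ≤ (M.ℓ i : ℤ) - 1 → y' i u = y i u := fun i u hu huℓ =>
    if_pos ⟨hu, huℓ⟩
  have hx_mem : ∀ i q, x' i q ∈ Set.Icc 0 (M.rate lam i) := fun i q => by
    dsimp only [x']
    split_ifs with hq
    · exact ⟨h.x_nonneg q.1 q.2 hq.1 i hq.2, h.x_le_rate hq.1 hq.2⟩
    · exact ⟨le_rfl, M.rate_nonneg lam i⟩
  have hy_mem : ∀ i u, y' i u ∈ Set.Icc 0 (M.rate lam i) := fun i u => by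
    dsimp only [y']
    split_ifs with hu
    · exact ⟨h.y_nonneg i u hu.1 hu.2, h.y_le_rate i hu.1 hu.2⟩
    · exact ⟨le_rfl, M.rate_nonneg lam i⟩
  exact ⟨(x', y'), ⟨⟨fun i q => (hx_mem i q).1, fun i u => (hy_mem i u).1⟩,
    ⟨fun i q => (hx_mem i q).2, fun i u => (hy_mem i u).2⟩⟩, h.congr hx hy, flowCost_congr hx hy⟩

theorem isFluidFeasible_iff :
    M.IsFluidFeasible lam x y ↔
      (∀ i, ∑ q ∈ M.soloStates with i ∈ M.compat q, x i q + y i (-(M.T : ℤ)) = M.rate lam i) ∧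
      (∀ j u, (j, u) ∈ M.soloStates →
        ∑ i ∈ M.compat (j, u), x i (j, u) + y j u = y j (u - 1)) ∧
      (∀ j u, (j, u) ∈ M.soloStates → ∀ i ∈ M.compat (j, u),
        (1 - ∑ k ∈ M.compat (j, u), M.rate lam k) * x i (j, u) ≤ M.rate lam i * y j u) ∧
      (∀ j u, (j, u) ∈ M.soloStates → ∀ i ∈ M.compat (j, u), 0 ≤ x i (j, u)) ∧
      ∀ i u, -(M.T : ℤ) ≤ u → u ≤ (M.ℓ i : ℤ) - 1 → 0 ≤ y i u :=
  ⟨fun h => ⟨h.1, h.2, h.3, h.4, h.5⟩, fun ⟨h₁, h₂, h₃, h₄, h₅⟩ => ⟨h₁, h₂, h₃, h₄, h₅⟩⟩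

theorem isClosed_setOf_isFluidFeasible (lam : M.PricingPolicy) :
    IsClosed {z : (Fin N → Fin N × ℤ → ℝ) × (Fin N → ℤ → ℝ) |
      M.IsFluidFeasible lam z.1 z.2} := by
  simp only [isFluidFeasible_iff, Set.ofPred_and, Set.ofPred_forall]
  refine .inter ?_ (.inter ?_ (.inter ?_ (.inter ?_ ?_))) <;>
    repeat' refine isClosed_iInter fun _ => ?_
  · exact isClosed_eq (by fun_prop) (by fun_prop)
  · exact isClosed_eq (by fun_prop) (by fun_prop)
  · exact isClosed_le (by fun_prop) (by fun_prop)
  · exact isClosed_le (by fun_prop) (by fun_prop)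
  · exact isClosed_le (by fun_prop) (by fun_prop)

theorem exists_isLeast_feasibleCosts (lam : M.PricingPolicy) :
    ∃ v, IsLeast (M.feasibleCosts lam) v := by
  let K : Set ((Fin N → Fin N × ℤ → ℝ) × (Fin N → ℤ → ℝ)) :=
    Set.Icc 0 (fun i _ => M.rate lam i, fun i _ => M.rate lam i) ∩
      {z | M.IsFluidFeasible lam z.1 z.2}
  have hK : IsCompact K := isCompact_Icc.inter_right (isClosed_setOf_isFluidFeasible lam)
  have himage : M.feasibleCosts lam = (fun z => M.flowCost z.1 z.2) '' K := by
    refine Set.Subset.antisymm ?_ ?_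
    · rintro _ ⟨x, y, h, rfl⟩
      obtain ⟨z, hz, hfeasible, hcost⟩ := h.exists_mem_Icc
      exact ⟨z, ⟨hz, hfeasible⟩, hcost⟩
    · rintro _ ⟨z, hz, rfl⟩
      exact ⟨z.1, z.2, hz.2, rfl⟩
  have hcont : Continuous fun z : (Fin N → Fin N × ℤ → ℝ) × (Fin N → ℤ → ℝ) =>
      M.flowCost z.1 z.2 := by
    unfold flowCost
    fun_prop
  have hnonempty : (M.feasibleCosts lam).Nonempty :=
    ⟨_, _, _, isFluidFeasible_unmatched lam, rfl⟩
  rw [himage] at hnonempty ⊢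
  exact (hK.image hcont).exists_isLeast hnonempty

theorem isLeast_fluidCost (lam : M.PricingPolicy) :
    IsLeast (M.feasibleCosts lam) (M.fluidCost lam) := by
  obtain ⟨v, hv⟩ := exists_isLeast_feasibleCosts lam
  rwa [fluidCost, hv.csInf_eq]

end LinearProgram

end RideModel

/-- For every initial state: the limits and the inner minima in the definitions of the two optimal
values exist, and the fluid value is an upper bound on the optimal long-run average profit. -/
theorem proposition1 {N : ℕ} (M : RideModel N) (s₀ : SystemState N) (hs₀ : s₀ ⊆ M.soloStates) :
    (∀ (lam : M.PricingPolicy) (φ : M.MatchingPolicy),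
      Tendsto (RideModel.averageProfit lam φ s₀) atTop
        (𝓝 (RideModel.longRunProfit lam φ s₀))) ∧
    (∀ lam : M.PricingPolicy, IsLeast (M.feasibleCosts lam) (M.fluidCost lam)) ∧
    M.optimalProfit s₀ ≤ M.fluidValue := by
  refine ⟨fun lam φ => ?_, RideModel.isLeast_fluidCost, iSup₂_le fun lam φ => ?_⟩
  · obtain ⟨x, y, -, hlim⟩ := RideModel.exists_isFluidFeasible_tendsto_averageProfit φ lam hs₀
    exact tendsto_nhds_limUnder ⟨_, hlim⟩
  · obtain ⟨x, y, hxy, hlim⟩ := RideModel.exists_isFluidFeasible_tendsto_averageProfit φ lam hs₀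
    refine le_iSup_of_le lam ?_
    rw [RideModel.longRunProfit, hlim.limUnder_eq, EReal.coe_le_coe_iff]
    exact sub_le_sub_left ((RideModel.isLeast_fluidCost lam).2 ⟨x, y, hxy, rfl⟩) _
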